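/- Let $R$ be a unital ring, not necessarily commutative, with group of invertible elements $\mathrm{GL}(1,R)$. Consider the partial maps $T_a: x\mapsto x+a$ ($a\in R$) and $M_{r,s}: x\mapsto rxs$ ($r,s\in \mathrm{GL}(1,R)$), defined on all of $R$, and $J: x\mapsto x^{-1}$, defined on $\mathrm{GL}(1,R)$. A string is a finite formal product of such maps; it acts as their composition, and is defined at those $x\in R$ at which every successive step is defined. Put $U_0=\mathrm{GL}(1,R)$ and, for $a_1,\dots,a_i\in R$, $$U_i(a_1,\dots,a_i)=\bigl(\mathrm{GL}(1,R)\cap (U_{i-1}(a_1,\dots,a_{i-1})-a_i)\bigr)^{-1},$$ where $X^{-1}$ denotes the set of inverses of the elements of $X$. Say that $\mathcal G(R)$ exists if all the sets $U_n(a_1,\dots,a_n)$ are nonempty and any two strings that are both defined on some $U_n(a_1,\dots,a_n)$ and agree there agree on every set on which both are defined. In that case, equality on the intersection of the domains is an equivalence relation on strings, and the equivalence classes form a group $\mathcal G(R)$ under stringing together (composition). Let $\mathrm E(2,R)$ be the subgroup of $\mathrm{GL}(2,R)$ generated by all matrices $\begin{pmatrix}1&a\\0&1\end{pmatrix}$ ($a\in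 R$), $\begin{pmatrix}r&0\\0&s\end{pmatrix}$ ($r,s\in\mathrm{GL}(1,R)$) and $\begin{pmatrix}0&1\\1&0\end{pmatrix}$. Let $\mathrm{PE}(2,R)$ be the quotient of $\mathrm E(2,R)$ by the group of scalar matrices $\lambda I$ with $\lambda$ an invertible element of the centre of $R$, and let $[\,\cdot\,]$ denote classes in $\mathrm{PE}(2,R)$. Suppose that $\mathcal G(R)$ exists. Then the assignment $$T_a\mapsto\left[\begin{pmatrix}1&a\\0&1\end{pmatrix}\right],\qquad M_{r,s}\mapsto\left[\begin{pmatrix}r&0\\0&s^{-1}\end{pmatrix}\right],\qquad J\mapsto\left[\begin{pmatrix}0&1\\1&0\end{pmatrix}\right]$$ for all $a\in R$ and $r,s\in \mathrm{GL}(1,R)$ extends to an isomorphism of groups $\mathcal G(R)\to \mathrm{PE}(2,R)$. -/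

import Mathlib

namespace FLT

/-! ### Strings of partially defined maps -/

/-- The generating partial maps: translations `T a`, two-sided multiplications `M r s`
by invertible elements, and the inversion `J`. -/
inductive Gen (R : Type*) [Ring R] where
  | T (a : R) : Gen R
  | M (r s : Rˣ) : Gen R
  | J : Gen R

/-- The partial map `R → R` attached to a generator:
`T a : x ↦ x + a` and `M r s : x ↦ r x s` on all of `R`, and `J : x ↦ x⁻¹` on the
invertible elements of `R`. -/
noncomputable def Gen.toPFun {R : Type*} [Ring R] : Gen R → (R →. R)
  | .T a => ((fun x => x + a : R → R) : R →. R)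
  | .M r s => ((fun x => (r : R) * x * (s : R) : R → R) : R →. R)
  | .J => fun x => ⟨IsUnit x, fun h => ((h.unit⁻¹ : Rˣ) : R)⟩

/-- The partial map of a formal string, composed like functions (the last letter acts first)
and defined wherever all the successive steps are defined. -/
noncomputable def eval {R : Type*} [Ring R] : List (Gen R) → (R →. R)
  | [] => PFun.id R
  | g :: w => g.toPFun.comp (eval w)

/-- Two strings agree on a set on which both are defined. -/
def AgreeOn {R : Type*} [Ring R] (w w' : List (Gen R)) (S : Set R) : Prop :=
  S ⊆ (eval w).Dom ∧ S ⊆ (eval w').Dom ∧ ∀ x ∈ S, eval w x = eval w' x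

/-- The basic domains `U₀ = GL(1,R)` and
`Uᵢ(a₁,…,aᵢ) = (GL(1,R) ∩ (Uᵢ₋₁(a₁,…,aᵢ₋₁) - aᵢ))⁻¹`; the list is `[aᵢ, …, a₁]`. -/
def U {R : Type*} [Ring R] : List R → Set R
  | [] => {z | IsUnit z}
  | b :: a => {z | ∃ u : Rˣ, (u : R) + b ∈ U a ∧ z = ((u⁻¹ : Rˣ) : R)}

/-- The condition under which the group of fractional linear transformations of `R` exists:
the basic domains are nonempty, and two strings that are defined and agree on one basic domain
agree on every set on which they are both defined. -/
structure GroupExists (R : Type*) [Ring R] : Prop where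
  nonempty : ∀ a : List R, (U a).Nonempty
  agree : ∀ (w w' : List (Gen R)) (a : List R), AgreeOn w w' (U a) →
    ∀ S : Set R, S ⊆ (eval w).Dom → S ⊆ (eval w').Dom → AgreeOn w w' S

/-- Equivalence of strings: equality on the intersection of their domains. -/
def Equivalent {R : Type*} [Ring R] (w w' : List (Gen R)) : Prop :=
  AgreeOn w w' ((eval w).Dom ∩ (eval w').Dom)

/-- The formal inverse of a generator. -/
def Gen.inv {R : Type*} [Ring R] : Gen R → Gen R
  | .T a => .T (-a)
  | .M r s => .M r⁻¹ s⁻¹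
  | .J => .J

/-- The formal inverse of a string. -/
def invString {R : Type*} [Ring R] (w : List (Gen R)) : List (Gen R) :=
  (w.map Gen.inv).reverse

/-! ### The group structure -/

section facts

variable {R : Type*} [Ring R]

theorem mem_eval_nil {x y : R} : y ∈ eval ([] : List (Gen R)) x ↔ y = x := by
  simp [eval, PFun.id]

theorem mem_eval_cons {g : Gen R} {w : List (Gen R)} {x y : R} :
    y ∈ eval (g :: w) x ↔ ∃ z ∈ eval w x, y ∈ g.toPFun z := by
  rw [eval, PFun.comp_apply]
  exact Part.mem_bind_iff

theorem mem_eval_append {w v : List (Gen R)} {x y : R} :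
    y ∈ eval (w ++ v) x ↔ ∃ z ∈ eval v x, y ∈ eval w z := by
  induction w generalizing y with
  | nil => simp [mem_eval_nil]
  | cons g w ih =>
    simp only [List.cons_append, mem_eval_cons, ih]
    constructor
    · rintro ⟨z, ⟨t, ht, htz⟩, hz⟩
      exact ⟨t, ht, z, htz, hz⟩
    · rintro ⟨t, ht, z, htz, hz⟩
      exact ⟨z, ⟨t, ht, htz⟩, hz⟩

theorem mem_T {a x y : R} : y ∈ (Gen.T a).toPFun x ↔ y = x + a := by
  simp [Gen.toPFun, PFun.coe_val]

theorem mem_M {r s : Rˣ} {x y : R} : y ∈ (Gen.M r s).toPFun x ↔ y = r * x * s := by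
  simp [Gen.toPFun, PFun.coe_val]

theorem mem_J {x y : R} :
    y ∈ (Gen.J : Gen R).toPFun x ↔ ∃ u : Rˣ, x = u ∧ y = ((u⁻¹ : Rˣ) : R) := by
  constructor
  · rintro ⟨h, rfl⟩
    exact ⟨IsUnit.unit h, rfl, rfl⟩
  · rintro ⟨u, rfl, rfl⟩
    refine ⟨u.isUnit, ?_⟩
    have : u.isUnit.unit = u := Units.ext rfl
    exact congrArg (fun v : Rˣ => ((v⁻¹ : Rˣ) : R)) this

theorem mem_inv {g : Gen R} {x y : R} (h : y ∈ g.toPFun x) : x ∈ g.inv.toPFun y := by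
  cases g with
  | T a => rw [mem_T] at h; simp [Gen.inv, mem_T, h]
  | M r s => rw [mem_M] at h; simp [Gen.inv, mem_M, h, mul_assoc]
  | J =>
    obtain ⟨u, rfl, rfl⟩ := mem_J.1 h
    exact mem_J.2 ⟨u⁻¹, rfl, by simp⟩

theorem mem_eval_invString {w : List (Gen R)} {x y : R} (h : y ∈ eval w x) :
    x ∈ eval (invString w) y := by
  induction w generalizing y with
  | nil => rw [mem_eval_nil] at h; simp [invString, mem_eval_nil, h]
  | cons g w ih =>
    obtain ⟨z, hz, hy⟩ := mem_eval_cons.1 h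
    have : invString (g :: w) = invString w ++ [g.inv] := by simp [invString]
    rw [this, mem_eval_append]
    exact ⟨z, mem_eval_cons.2 ⟨y, mem_eval_nil.2 rfl, mem_inv hy⟩, ih hz⟩

theorem invString_invString (w : List (Gen R)) : invString (invString w) = w := by
  have : (Gen.inv ∘ Gen.inv : Gen R → Gen R) = id := by
    funext g
    cases g <;> simp [Gen.inv]
  simp [invString, this]

theorem mem_U_cons {b z : R} {a : List R} :
    z ∈ U (b :: a) ↔ ∃ u : Rˣ, (u : R) + b ∈ U a ∧ z = ((u⁻¹ : Rˣ) : R) := Iff.rfl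

theorem exists_U_M (r s : Rˣ) (a : List R) :
    ∃ a' : List R, ∀ x ∈ U a', (r : R) * x * s ∈ U a := by
  induction a generalizing r s with
  | nil =>
    refine ⟨[], ?_⟩
    rintro _ ⟨u, rfl⟩
    exact ⟨r * u * s, by simp⟩
  | cons b a ih =>
    obtain ⟨a', h⟩ := ih s⁻¹ r⁻¹
    refine ⟨(s * b * r) :: a', ?_⟩
    rintro _ ⟨u, hu, rfl⟩
    refine ⟨s⁻¹ * u * r⁻¹, ?_, by simp [mul_assoc]⟩
    convert h _ hu using 1
    simp [mul_add, add_mul, mul_assoc]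

theorem exists_U_gen (g : Gen R) (a : List R) :
    ∃ a' : List R, ∀ x ∈ U a', ∃ y ∈ g.toPFun x, y ∈ U a := by
  cases g with
  | T b =>
    refine ⟨0 :: b :: a, ?_⟩
    rintro _ ⟨u, ⟨v, hv, huv⟩, rfl⟩
    refine ⟨_, mem_T.2 rfl, ?_⟩
    have : u⁻¹ = v := by
      rw [add_zero] at huv
      rw [Units.ext huv, inv_inv]
    rwa [this]
  | M r s =>
    obtain ⟨a', h⟩ := exists_U_M r s a
    exact ⟨a', fun x hx => ⟨_, mem_M.2 rfl, h x hx⟩⟩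
  | J =>
    refine ⟨0 :: a, ?_⟩
    rintro _ ⟨u, hu, rfl⟩
    exact ⟨u, mem_J.2 ⟨u⁻¹, rfl, by simp⟩, by simpa using hu⟩

theorem exists_U_eval (w : List (Gen R)) (a : List R) :
    ∃ a' : List R, ∀ x ∈ U a', ∃ y ∈ eval w x, y ∈ U a := by
  induction w generalizing a with
  | nil => exact ⟨a, fun x hx => ⟨x, mem_eval_nil.2 rfl, hx⟩⟩
  | cons g w ih =>
    obtain ⟨a₁, h₁⟩ := exists_U_gen g a
    obtain ⟨a', h'⟩ := ih a₁
    refine ⟨a', fun x hx => ?_⟩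
    obtain ⟨z, hz, hzU⟩ := h' x hx
    obtain ⟨y, hy, hyU⟩ := h₁ z hzU
    exact ⟨y, mem_eval_cons.2 ⟨z, hz, hy⟩, hyU⟩

/-- Finitely many strings have a basic domain on which all of them are defined. -/
theorem exists_U_subset_dom₃ (w w' w'' : List (Gen R)) :
    ∃ a : List R, U a ⊆ (eval w).Dom ∧ U a ⊆ (eval w').Dom ∧ U a ⊆ (eval w'').Dom := by
  obtain ⟨a, h⟩ := exists_U_eval (w'' ++ (invString w' ++ (w' ++ (invString w ++ w)))) []
  have key : ∀ x ∈ U a, x ∈ (eval w).Dom ∧ x ∈ (eval w').Dom ∧ x ∈ (eval w'').Dom := by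
    intro x hx
    obtain ⟨y, hy, -⟩ := h x hx
    obtain ⟨x₃, h₃, h₃'⟩ := mem_eval_append.1 hy
    obtain ⟨y₂, h₂, h₂'⟩ := mem_eval_append.1 h₃
    obtain ⟨x₁, h₁, h₁'⟩ := mem_eval_append.1 h₂
    obtain ⟨y₀, h₀, h₀'⟩ := mem_eval_append.1 h₁
    have e₁ : x₁ = x := Part.mem_unique h₀' (mem_eval_invString h₀)
    subst e₁
    have e₃ : x₃ = x₁ := Part.mem_unique h₂' (mem_eval_invString h₁')
    subst e₃
    exact ⟨(PFun.mem_dom _ _).2 ⟨_, h₀⟩, (PFun.mem_dom _ _).2 ⟨_, h₁'⟩,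
      (PFun.mem_dom _ _).2 ⟨_, h₃'⟩⟩
  exact ⟨a, fun x hx => (key x hx).1, fun x hx => (key x hx).2.1, fun x hx => (key x hx).2.2⟩

theorem equivalent_iff {w w' : List (Gen R)} :
    Equivalent w w' ↔ ∀ x, ∀ y ∈ eval w x, ∀ y' ∈ eval w' x, y = y' := by
  constructor
  · intro h x y hy y' hy'
    have := h.2.2 x ⟨(PFun.mem_dom _ _).2 ⟨_, hy⟩, (PFun.mem_dom _ _).2 ⟨_, hy'⟩⟩
    rw [← this] at hy'
    exact Part.mem_unique hy hy'
  · refine fun h => ⟨Set.inter_subset_left, Set.inter_subset_right, ?_⟩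
    rintro x ⟨hx, hx'⟩
    obtain ⟨y, hy⟩ := (PFun.mem_dom _ _).1 hx
    obtain ⟨y', hy'⟩ := (PFun.mem_dom _ _).1 hx'
    have := h x y hy y' hy'
    subst this
    rw [Part.eq_some_iff.2 hy, Part.eq_some_iff.2 hy']

theorem Equivalent.refl (w : List (Gen R)) : Equivalent w w :=
  equivalent_iff.2 fun _ _ hy _ hy' => Part.mem_unique hy hy'

theorem Equivalent.symm {w w' : List (Gen R)} (h : Equivalent w w') : Equivalent w' w :=
  equivalent_iff.2 fun x y hy y' hy' => (equivalent_iff.1 h x y' hy' y hy).symm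

theorem Equivalent.trans (hR : GroupExists R) {w w' w'' : List (Gen R)}
    (h : Equivalent w w') (h' : Equivalent w' w'') : Equivalent w w'' := by
  obtain ⟨a, h₁, h₂, h₃⟩ := exists_U_subset_dom₃ w w' w''
  refine hR.agree w w'' a ⟨h₁, h₃, fun x hx => ?_⟩ _ Set.inter_subset_left Set.inter_subset_right
  exact (h.2.2 x ⟨h₁ hx, h₂ hx⟩).trans (h'.2.2 x ⟨h₂ hx, h₃ hx⟩)

theorem Equivalent.append {w w' v v' : List (Gen R)}
    (h : Equivalent w w') (h' : Equivalent v v') : Equivalent (w ++ v) (w' ++ v') := by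
  refine equivalent_iff.2 fun x y hy y' hy' => ?_
  obtain ⟨z, hz, hzy⟩ := mem_eval_append.1 hy
  obtain ⟨z', hz', hzy'⟩ := mem_eval_append.1 hy'
  have := equivalent_iff.1 h' x z hz z' hz'
  subst this
  exact equivalent_iff.1 h z y hzy y' hzy'

theorem equivalent_invString_append (w : List (Gen R)) : Equivalent (invString w ++ w) [] := by
  refine equivalent_iff.2 fun x y hy y' hy' => ?_
  obtain ⟨z, hz, hzy⟩ := mem_eval_append.1 hy
  rw [mem_eval_nil] at hy'
  subst hy'
  exact Part.mem_unique hzy (mem_eval_invString hz)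

theorem equivalent_append_invString (w : List (Gen R)) : Equivalent (w ++ invString w) [] := by
  simpa [invString_invString] using equivalent_invString_append (invString w)

theorem Equivalent.invString (hR : GroupExists R) {w w' : List (Gen R)}
    (h : Equivalent w w') : Equivalent (FLT.invString w) (FLT.invString w') := by
  have h₁ : Equivalent (FLT.invString w) (FLT.invString w ++ (w' ++ FLT.invString w')) := by
    simpa using (Equivalent.refl (FLT.invString w)).append (equivalent_append_invString w').symm
  have h₂ : Equivalent (FLT.invString w ++ (w' ++ FLT.invString w'))
      (FLT.invString w ++ (w ++ FLT.invString w')) :=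
    (Equivalent.refl _).append (h.symm.append (Equivalent.refl _))
  have h₃ : Equivalent (FLT.invString w ++ (w ++ FLT.invString w')) (FLT.invString w') := by
    simpa using (equivalent_invString_append w).append (Equivalent.refl (FLT.invString w'))
  exact (h₁.trans hR h₂).trans hR h₃

end facts

/-- Equivalence of strings as a setoid, when the group exists. -/
def stringSetoid {R : Type*} [Ring R] (hR : GroupExists R) : Setoid (List (Gen R)) where
  r := Equivalent
  iseqv := ⟨Equivalent.refl, Equivalent.symm, Equivalent.trans hR⟩

/-- The group of fractional linear transformations: equivalence classes of strings. -/
def G {R : Type*} [Ring R] (hR : GroupExists R) : Type _ := Quotient (stringSetoid hR)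

/-- The class of a string. -/
def G.mk {R : Type*} [Ring R] (hR : GroupExists R) (w : List (Gen R)) : G hR :=
  Quotient.mk (stringSetoid hR) w

/-- The product is induced by stringing together, that is, by composition. -/
instance {R : Type*} [Ring R] (hR : GroupExists R) : Group (G hR) where
  mul := Quotient.map₂ (· ++ ·) fun _ _ h _ _ h' => Equivalent.append h h'
  one := G.mk hR []
  inv := Quotient.map invString fun _ _ h => Equivalent.invString hR h
  mul_assoc := by
    rintro ⟨x⟩ ⟨y⟩ ⟨z⟩
    exact congrArg (G.mk hR) (List.append_assoc x y z)
  one_mul := by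
    rintro ⟨x⟩
    exact congrArg (G.mk hR) (List.nil_append x)
  mul_one := by
    rintro ⟨x⟩
    exact congrArg (G.mk hR) (List.append_nil x)
  inv_mul_cancel := by
    rintro ⟨x⟩
    exact Quotient.sound (s := stringSetoid hR) (equivalent_invString_append x)

/-! ### The projective elementary group -/

section matrices

variable {R : Type*} [Ring R]

/-- The matrix `[[1, a], [0, 1]]` in `GL(2,R)`. -/
def t (a : R) : (Matrix (Fin 2) (Fin 2) R)ˣ where
  val := !![1, a; 0, 1]
  inv := !![1, -a; 0, 1]
  val_inv := by simp [Matrix.one_fin_two]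
  inv_val := by simp [Matrix.one_fin_two]

/-- The matrix `diag(r, s)` in `GL(2,R)`. -/
def m (r s : Rˣ) : (Matrix (Fin 2) (Fin 2) R)ˣ where
  val := !![(r : R), 0; 0, (s : R)]
  inv := !![((r⁻¹ : Rˣ) : R), 0; 0, ((s⁻¹ : Rˣ) : R)]
  val_inv := by simp [Matrix.one_fin_two]
  inv_val := by simp [Matrix.one_fin_two]

/-- The matrix `[[0, 1], [1, 0]]` in `GL(2,R)`. -/
def j : (Matrix (Fin 2) (Fin 2) R)ˣ where
  val := !![0, 1; 1, 0]
  inv := !![0, 1; 1, 0]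
  val_inv := by simp [Matrix.one_fin_two]
  inv_val := by simp [Matrix.one_fin_two]

end matrices

/-- `E(2,R)`, the subgroup of `GL(2,R)` generated by all `t a`, `m r s` and `j`. -/
def E2 (R : Type*) [Ring R] : Subgroup (Matrix (Fin 2) (Fin 2) R)ˣ :=
  Subgroup.closure
    (Set.range t ∪ Set.range (fun p : Rˣ × Rˣ => m p.1 p.2) ∪ {j})

/-- The scalar matrices in `E(2,R)` whose scalar is an invertible element of the centre of `R`. -/
def centralScalars (R : Type*) [Ring R] : Subgroup (E2 R) :=
  (Units.map ((Matrix.scalar (Fin 2)).comp (Subring.center R).subtype).toMonoidHom).range.subgroupOf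
    (E2 R)

instance (R : Type*) [Ring R] : (centralScalars R).Normal where
  conj_mem := by
    rintro x ⟨z, hz⟩ g
    refine ⟨z, ?_⟩
    have comm : ∀ A : (Matrix (Fin 2) (Fin 2) R)ˣ, A * (x : (Matrix (Fin 2) (Fin 2) R)ˣ)
        = (x : (Matrix (Fin 2) (Fin 2) R)ˣ) * A := by
      intro A
      have hz' : (x : (Matrix (Fin 2) (Fin 2) R)ˣ) = _ := hz.symm
      rw [hz']
      ext i k
      simpa using ((Subring.mem_center_iff.1 (z : Subring.center R).2)
        ((A : Matrix (Fin 2) (Fin 2) R) i k))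
    rw [hz]
    simp [comm]

/-- `PE(2,R)`, the projective elementary group. -/
abbrev PE2 (R : Type*) [Ring R] : Type _ := E2 R ⧸ centralScalars R

/-- The class in `PE(2,R)` of an element of `E(2,R)`. -/
def PE2.mk {R : Type*} [Ring R] (g : (Matrix (Fin 2) (Fin 2) R)ˣ) (hg : g ∈ E2 R) : PE2 R :=
  QuotientGroup.mk (s := centralScalars R) ⟨g, hg⟩

theorem t_mem {R : Type*} [Ring R] (a : R) : t a ∈ E2 R :=
  Subgroup.subset_closure (Or.inl (Or.inl ⟨a, rfl⟩))

theorem m_mem {R : Type*} [Ring R] (r s : Rˣ) : m r s ∈ E2 R :=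
  Subgroup.subset_closure (Or.inl (Or.inr ⟨(r, s), rfl⟩))

theorem j_mem {R : Type*} [Ring R] : (j : (Matrix (Fin 2) (Fin 2) R)ˣ) ∈ E2 R :=
  Subgroup.subset_closure (Or.inr rfl)

end FLT

/-! Over `R`, a string acts on a point `x` where it is defined as the product of the matrices of its
letters acts on the point `[x : 1]` of the projective line, column vectors being taken up to right
multiplication by units. So strings with the same matrix agree wherever both are defined, and
strings with a central scalar matrix act as the identity.

Conversely, let the string `w` act as the identity. It is defined at some `y`, and conjugating it by
`x ↦ x⁻¹ + y`, which sends `∞` to `y`, makes its matrix fix `∞ = [1 : 0]`, that is, upper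
triangular. Such a matrix is also that of an affine string `x ↦ r x s + c`, defined on all of `R`.
An affine string that acts as the identity has `c = 0` and `r = s⁻¹` central, so its matrix is
scalar, and conjugating back does not change that. -/

namespace FLT

open Matrix MulOpposite

variable {R : Type*} [Ring R]

/-- The matrix `A` sends the point `[x : 1]` of the projective line over `R` to `[y : 1]`.
Homogeneous coordinates are columns up to right multiplication by a unit, so that matrices act
on the left. -/
def MobiusMapsTo (A : Matrix (Fin 2) (Fin 2) R) (x y : R) : Prop :=
  ∃ u : Rˣ, A *ᵥ ![x, 1] = op (u : R) • ![y, 1]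

theorem MobiusMapsTo.one (x : R) : MobiusMapsTo 1 x x :=
  ⟨1, by simp⟩

theorem MobiusMapsTo.mul {A B : Matrix (Fin 2) (Fin 2) R} {x y z : R}
    (hA : MobiusMapsTo A z y) (hB : MobiusMapsTo B x z) : MobiusMapsTo (A * B) x y := by
  obtain ⟨u, hu⟩ := hA
  obtain ⟨v, hv⟩ := hB
  exact ⟨u * v, by rw [← mulVec_mulVec, hv, mulVec_smul, hu, smul_smul, Units.val_mul, op_mul]⟩

theorem MobiusMapsTo.unique {A : Matrix (Fin 2) (Fin 2) R} {x y y' : R}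
    (h : MobiusMapsTo A x y) (h' : MobiusMapsTo A x y') : y = y' := by
  obtain ⟨u, hu⟩ := h
  obtain ⟨v, hv⟩ := h'
  have heq := hu.symm.trans hv
  obtain rfl : u = v := Units.ext (by simpa using congrFun heq 1)
  simpa using congrFun heq 0

theorem mobiusMapsTo_of_mem_centralScalars {g : E2 R} (hg : g ∈ centralScalars R) (x : R) :
    MobiusMapsTo g.val.val x x := by
  obtain ⟨z, hz : _ = g.val⟩ := hg
  refine ⟨Units.map (Subring.center R).subtype.toMonoidHom z, ?_⟩
  have hcomm := Subring.mem_center_iff.1 z.val.2 x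
  rw [← hz]
  ext i
  fin_cases i <;> simp [hcomm]

theorem m_self_mem_centralScalars {z : Rˣ} (hz : (z : R) ∈ Subring.center R) :
    ⟨m z z, m_mem z z⟩ ∈ centralScalars R := by
  have hz_inv : ((z⁻¹ : Rˣ) : R) ∈ Subring.center R := Subring.mem_center_iff.2 fun x =>
    Commute.units_inv_right (Subring.mem_center_iff.1 hz x)
  refine ⟨⟨⟨z, hz⟩, ⟨_, hz_inv⟩, Subtype.ext (by simp), Subtype.ext (by simp)⟩, Units.ext ?_⟩
  ext i k
  fin_cases i <;> fin_cases k <;> simp [m]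

theorem exists_eq_t_mul_m {A : (Matrix (Fin 2) (Fin 2) R)ˣ} {u : Rˣ}
    (h₀₀ : A.val 0 0 = u) (h₁₀ : A.val 1 0 = 0) : ∃ (c : R) (a : Rˣ), A = t c * m u a := by
  set B := A⁻¹
  have hAB : A.val * B.val = 1 := A.mul_inv
  have hBA : B.val * A.val = 1 := A.inv_mul
  have hB₁₀ : B.val 1 0 = 0 := by simpa [mul_apply, h₀₀, h₁₀] using congrFun₂ hBA 1 0
  let a : Rˣ :=
    { val := A.val 1 1
      inv := B.val 1 1
      val_inv := by simpa [mul_apply, h₁₀] using congrFun₂ hAB 1 1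
      inv_val := by simpa [mul_apply, hB₁₀] using congrFun₂ hBA 1 1 }
  refine ⟨A.val 0 1 * (a⁻¹ : Rˣ), a, Units.ext ?_⟩
  have ha : A.val 1 1 = a := rfl
  ext i k
  fin_cases i <;> fin_cases k <;> simp [t, m, h₀₀, h₁₀, ha]

/-- The element of `E(2,R)` whose action on the projective line extends a generator; the second
diagonal entry for `M r s` is `s⁻¹`, since scaling the lower homogeneous coordinate by `s⁻¹`
multiplies `x` by `s` on the right. -/
def Gen.toE2 : Gen R → E2 R
  | .T a => ⟨t a, t_mem a⟩
  | .M r s => ⟨m r s⁻¹, m_mem r s⁻¹⟩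
  | .J => ⟨j, j_mem⟩

theorem Gen.toE2_inv (g : Gen R) : g.inv.toE2 = g.toE2⁻¹ := by
  apply Subtype.ext
  cases g <;> exact Units.ext (by simp [Gen.inv, Gen.toE2, t, m, j])

theorem Gen.mobiusMapsTo_of_mem_toPFun {g : Gen R} {x y : R} (h : y ∈ g.toPFun x) :
    MobiusMapsTo g.toE2.val.val x y := by
  cases g with
  | T a =>
    obtain rfl := mem_T.1 h
    exact ⟨1, by simp [Gen.toE2, t]⟩
  | M r s =>
    obtain rfl := mem_M.1 h
    exact ⟨s⁻¹, by simp [Gen.toE2, m]⟩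
  | J =>
    obtain ⟨u, rfl, rfl⟩ := mem_J.1 h
    exact ⟨u, by simp [Gen.toE2, j]⟩

/-- The element of `E(2,R)` attached to a string: the product of those of its letters. -/
def toE2 (w : List (Gen R)) : E2 R := (w.map Gen.toE2).prod

theorem toE2_singleton (g : Gen R) : toE2 [g] = g.toE2 := by
  simp [toE2]

theorem toE2_cons (g : Gen R) (w : List (Gen R)) : toE2 (g :: w) = g.toE2 * toE2 w := by
  simp [toE2]

theorem toE2_append (w v : List (Gen R)) : toE2 (w ++ v) = toE2 w * toE2 v := by
  simp [toE2]

theorem toE2_invString (w : List (Gen R)) : toE2 (invString w) = (toE2 w)⁻¹ := by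
  simp [toE2, invString, List.prod_inv_reverse, Function.comp_def, Gen.toE2_inv]

theorem toE2_surjective : Function.Surjective (toE2 : List (Gen R) → E2 R) := by
  rintro ⟨g, hg⟩
  induction hg using Subgroup.closure_induction with
  | mem g hg =>
    obtain (⟨a, rfl⟩ | ⟨⟨r, s⟩, rfl⟩) | rfl := hg
    · exact ⟨[.T a], toE2_singleton _⟩
    · exact ⟨[.M r s⁻¹], by simp [toE2_singleton, Gen.toE2]⟩
    · exact ⟨[.J], toE2_singleton _⟩
  | one => exact ⟨[], rfl⟩
  | mul g g' _ _ hg hg' =>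
    obtain ⟨w, hw⟩ := hg
    obtain ⟨w', hw'⟩ := hg'
    exact ⟨w ++ w', by rw [toE2_append, hw, hw']; rfl⟩
  | inv g _ hg =>
    obtain ⟨w, hw⟩ := hg
    exact ⟨invString w, by rw [toE2_invString, hw]; rfl⟩

theorem mobiusMapsTo_of_mem_eval {w : List (Gen R)} {x y : R} (h : y ∈ eval w x) :
    MobiusMapsTo (toE2 w).val.val x y := by
  induction w generalizing y with
  | nil =>
    obtain rfl := mem_eval_nil.1 h
    exact .one y
  | cons g w ih =>
    obtain ⟨z, hz, hy⟩ := mem_eval_cons.1 h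
    rw [toE2_cons]
    exact (Gen.mobiusMapsTo_of_mem_toPFun hy).mul (ih hz)

theorem equivalent_of_toE2_eq {w w' : List (Gen R)} (h : toE2 w = toE2 w') : Equivalent w w' :=
  equivalent_iff.2 fun _ _ hy _ hy' =>
    (mobiusMapsTo_of_mem_eval hy).unique (h ▸ mobiusMapsTo_of_mem_eval hy')

theorem equivalent_nil_of_toE2_mem_centralScalars {w : List (Gen R)}
    (h : toE2 w ∈ centralScalars R) : Equivalent w [] := by
  refine equivalent_iff.2 fun x y hy x' hx' => ?_
  obtain rfl := mem_eval_nil.1 hx'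
  exact (mobiusMapsTo_of_mem_eval hy).unique (mobiusMapsTo_of_mem_centralScalars h _)

theorem toE2_T_M_mem_centralScalars {c : R} {r s : Rˣ} (h : Equivalent [.T c, .M r s] []) :
    toE2 [.T c, .M r s] ∈ centralScalars R := by
  have fixes (x : R) : r * x * s + c = x :=
    equivalent_iff.1 h x _
      (mem_eval_cons.2 ⟨_, mem_eval_cons.2 ⟨x, mem_eval_nil.2 rfl, mem_M.2 rfl⟩, mem_T.2 rfl⟩)
      x (mem_eval_nil.2 rfl)
  obtain rfl : c = 0 := by simpa using fixes 0
  obtain rfl : r = s⁻¹ := eq_inv_of_mul_eq_one_left (Units.ext (by simpa using fixes 1))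
  have hcenter : ((s⁻¹ : Rˣ) : R) ∈ Subring.center R := Subring.mem_center_iff.2 fun x =>
    ((Units.eq_mul_inv_iff_mul_eq s).2 (by simpa using fixes x)).symm
  convert m_self_mem_centralScalars hcenter using 1
  exact Subtype.ext (Units.ext (by simp [toE2, Gen.toE2, t, m]))

theorem exists_mem_eval_self (hR : GroupExists R) {w : List (Gen R)} (h : Equivalent w []) :
    ∃ y, y ∈ eval w y := by
  obtain ⟨a, ha⟩ := exists_U_eval w []
  obtain ⟨x, hx⟩ := hR.nonempty a
  obtain ⟨y, hy, -⟩ := ha x hx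
  obtain rfl : y = x := equivalent_iff.1 h x y hy x (mem_eval_nil.2 rfl)
  exact ⟨y, hy⟩

theorem exists_toE2_conj_eq_toE2_T_M {w : List (Gen R)} {y : R} (h : y ∈ eval w y) :
    ∃ (c : R) (r s : Rˣ),
      toE2 (invString [.T y, .J] ++ (w ++ [.T y, .J])) = toE2 [.T c, .M r s] := by
  obtain ⟨u, hu⟩ := mobiusMapsTo_of_mem_eval h
  set W := (toE2 w).val
  set A := (t y * j)⁻¹ * (W * (t y * j))
  have h_infty : (t y * j).val *ᵥ ![1, 0] = ![y, 1] := by simp [t, j]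
  have hA : A.val *ᵥ ![1, 0] = op (u : R) • ![1, 0] := by
    calc A.val *ᵥ ![1, 0]
      _ = (t y * j)⁻¹.val *ᵥ W.val *ᵥ (t y * j).val *ᵥ ![1, 0] := by
        simp only [A, Units.val_mul, mulVec_mulVec]
      _ = op (u : R) • (t y * j)⁻¹.val *ᵥ (t y * j).val *ᵥ ![1, 0] := by
        rw [h_infty, hu, mulVec_smul]
      _ = op (u : R) • ![1, 0] := by rw [mulVec_mulVec, Units.inv_mul, one_mulVec]
  obtain ⟨c, a, hca⟩ : ∃ (c : R) (a : Rˣ), A = t c * m u a :=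
    exists_eq_t_mul_m (by simpa [mulVec, dotProduct] using congrFun hA 0)
      (by simpa [mulVec, dotProduct] using congrFun hA 1)
  have hconj : toE2 [.T y, .J] = ⟨t y * j, mul_mem (t_mem y) j_mem⟩ := by
    simp [toE2, Gen.toE2]
  have h_affine : (toE2 [.T c, .M u a⁻¹]).val = t c * m u a := by simp [toE2, Gen.toE2]
  refine ⟨c, u, a⁻¹, Subtype.ext ?_⟩
  rw [toE2_append, toE2_append, toE2_invString, hconj, h_affine, ← hca]
  rfl

theorem G.mk_eq_mk_iff {hR : GroupExists R} {w w' : List (Gen R)} :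
    G.mk hR w = G.mk hR w' ↔ Equivalent w w' :=
  Quotient.eq (r := stringSetoid hR)

theorem G.mk_append (hR : GroupExists R) (w v : List (Gen R)) :
    G.mk hR (w ++ v) = G.mk hR w * G.mk hR v := rfl

theorem G.mk_invString (hR : GroupExists R) (w : List (Gen R)) :
    G.mk hR (invString w) = (G.mk hR w)⁻¹ := rfl

theorem G.mk_eq_one_iff {hR : GroupExists R} {w : List (Gen R)} :
    G.mk hR w = 1 ↔ toE2 w ∈ centralScalars R := by
  refine ⟨fun h => ?_, fun h => mk_eq_mk_iff.2 (equivalent_nil_of_toE2_mem_centralScalars h)⟩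
  obtain ⟨y, hy⟩ := exists_mem_eval_self hR (mk_eq_mk_iff.1 h)
  obtain ⟨c, r, s, hconj⟩ := exists_toE2_conj_eq_toE2_T_M hy
  have h_affine : G.mk hR [.T c, .M r s] = 1 := by
    rw [← mk_eq_mk_iff.2 (equivalent_of_toE2_eq hconj), mk_append, mk_append, mk_invString, h,
      one_mul, inv_mul_cancel]
  have hmem := toE2_T_M_mem_centralScalars (mk_eq_mk_iff.1 h_affine)
  rw [← hconj, toE2_append, toE2_append, toE2_invString] at hmem
  rwa [Subgroup.Normal.mem_comm_iff inferInstance, mul_assoc, mul_inv_cancel, mul_one] at hmem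

theorem G.mk_eq_mk_iff_toE2 {hR : GroupExists R} {w w' : List (Gen R)} :
    G.mk hR w = G.mk hR w' ↔ (toE2 w : PE2 R) = toE2 w' := by
  rw [← inv_mul_eq_one, ← mk_invString, ← mk_append, mk_eq_one_iff, toE2_append, toE2_invString,
    QuotientGroup.eq]

/-- The homomorphism from the group of fractional linear transformations to `PE(2,R)` that sends
the class of a string to the class of its matrix. -/
def G.toPE2 (hR : GroupExists R) : G hR →* PE2 R where
  toFun := Quotient.lift (s := stringSetoid hR) (fun w => (toE2 w : PE2 R)) fun _ _ h =>
    mk_eq_mk_iff_toE2.1 (mk_eq_mk_iff (hR := hR).2 h)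
  map_one' := rfl
  map_mul' := by
    rintro ⟨w⟩ ⟨v⟩
    exact congrArg (QuotientGroup.mk (s := centralScalars R)) (toE2_append w v)

theorem G.toPE2_mk_singleton (hR : GroupExists R) (g : Gen R) :
    toPE2 hR (G.mk hR [g]) = (g.toE2 : PE2 R) :=
  congrArg (QuotientGroup.mk (s := centralScalars R)) (toE2_singleton g)

theorem G.toPE2_bijective (hR : GroupExists R) : Function.Bijective (toPE2 hR) := by
  constructor
  · rintro ⟨w⟩ ⟨w'⟩ h
    exact mk_eq_mk_iff_toE2.2 h
  · rintro ⟨g⟩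
    obtain ⟨w, rfl⟩ := toE2_surjective g
    exact ⟨G.mk hR w, rfl⟩

end FLT

theorem mainTheorem5 {R : Type*} [Ring R] (hR : FLT.GroupExists R) :
    ∃ φ : FLT.G hR ≃* FLT.PE2 R,
      (∀ a : R, φ (FLT.G.mk hR [FLT.Gen.T a]) = FLT.PE2.mk (FLT.t a) (FLT.t_mem a)) ∧
      (∀ r s : Rˣ, φ (FLT.G.mk hR [FLT.Gen.M r s]) =
        FLT.PE2.mk (FLT.m r s⁻¹) (FLT.m_mem r s⁻¹)) ∧
      φ (FLT.G.mk hR [FLT.Gen.J]) = FLT.PE2.mk FLT.j FLT.j_mem :=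
  ⟨MulEquiv.ofBijective (FLT.G.toPE2 hR) (FLT.G.toPE2_bijective hR),
    fun a => FLT.G.toPE2_mk_singleton hR (.T a),
    fun r s => FLT.G.toPE2_mk_singleton hR (.M r s),
    FLT.G.toPE2_mk_singleton hR .J⟩
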